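/- Let $k$ be an algebraically closed field of characteristic zero and let $X$ be a smooth irreducible algebraic variety over $k$ (a smooth, separated, quasi-compact, irreducible $k$-scheme). Write $\mathrm{Ext}^p$ for the Ext groups of $\mathcal{O}_X$-modules (for coherent sheaves they agree with those computed in the bounded derived category of coherent sheaves on $X$). A vector bundle (locally free sheaf of finite rank) $M$ on $X$ is *exceptional* if it is simple, i.e. $\mathrm{Hom}(M,M)=k$, and $\mathrm{Ext}^p(M,M)=0$ for all $p\ge 1$. An ordered pair $(E,F)$ of vector bundles on $X$ is *strongly exceptional* if $E$ and $F$ are exceptional, $\mathrm{Ext}^p(F,E)=0$ for all $p$, and $\mathrm{Ext}^p(E,F)=0$ for all $p\neq 0$. A vector bundle $C$ on $X$ is a *Steiner bundle of type $(E,F)$* if $(E,F)$ is a strongly exceptional pair of vector bundles such that $E^*\otimes F$ is globally generated, and there is a short exact sequence $$0\longrightarrow E^{a}\longrightarrow F^{b}\longrightarrow C\longrightarrow 0$$ for some integers $a,b\ge 1$. If $C_1$ and $C_2$ are Steiner bundles of the same type $(E,F)$ (with possibly different exponents $a,b$), then $\mathrm{Ext}^p(C_1,C_2)=0$ for all $p\ge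 2$. -/

import Mathlib

open CategoryTheory CategoryTheory.Limits AlgebraicGeometry TopologicalSpace

universe u

namespace SteinerBundles

noncomputable section

section InternalHom

variable {X : Scheme.{u}}

/-- The sections over `U` of the sheaf of homomorphisms `ℋom(M, N)`: families of `𝒪_X(V)`-linear
maps `M(V) → N(V)`, for `V ⊆ U` open, that are compatible with restriction. -/
def homSections (M N : X.Modules) (U : X.Opens) :
    AddSubgroup (∀ V : {V : X.Opens // V ≤ U}, Γ(M, V.1) →ₗ[Γ(X, V.1)] Γ(N, V.1)) where
  carrier := {φ | ∀ (V W : {V : X.Opens // V ≤ U}) (h : W.1 ≤ V.1) (s : Γ(M, V.1)),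
    φ W (M.presheaf.map (homOfLE h).op s) = N.presheaf.map (homOfLE h).op (φ V s)}
  add_mem' := by
    intro φ ψ hφ hψ V W h s
    simp [hφ V W h s, hψ V W h s]
  zero_mem' := by
    intro V W h s
    simp
  neg_mem' := by
    intro φ hφ V W h s
    simp [hφ V W h s]

/-- The `𝒪_X(U)`-module structure: `(r • φ)_V = r|_V • φ_V`. -/
instance (M N : X.Modules) (U : X.Opens) : Module Γ(X, U) (homSections M N U) where
  smul r φ := ⟨fun V => X.presheaf.map (homOfLE V.2).op r • φ.1 V, by
    intro V W h s
    have h1 := φ.2 V W h s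
    simp only [LinearMap.smul_apply, h1, Scheme.Modules.map_smul]
    rw [← ConcreteCategory.comp_apply, ← X.presheaf.map_comp]
    rfl⟩
  one_smul φ := by
    apply Subtype.ext; funext V
    change X.presheaf.map (homOfLE V.2).op 1 • φ.1 V = φ.1 V
    rw [map_one, one_smul]
  mul_smul r s φ := by
    apply Subtype.ext; funext V
    change X.presheaf.map (homOfLE V.2).op (r * s) • φ.1 V =
      X.presheaf.map (homOfLE V.2).op r • X.presheaf.map (homOfLE V.2).op s • φ.1 V
    rw [map_mul, mul_smul]
  smul_zero r := by
    apply Subtype.ext; funext V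
    exact smul_zero (X.presheaf.map (homOfLE V.2).op r)
  smul_add r φ ψ := by
    apply Subtype.ext; funext V
    exact smul_add (X.presheaf.map (homOfLE V.2).op r) (φ.1 V) (ψ.1 V)
  add_smul r s φ := by
    apply Subtype.ext; funext V
    change X.presheaf.map (homOfLE V.2).op (r + s) • φ.1 V =
      X.presheaf.map (homOfLE V.2).op r • φ.1 V + X.presheaf.map (homOfLE V.2).op s • φ.1 V
    rw [map_add, add_smul]
  zero_smul φ := by
    apply Subtype.ext; funext V
    change X.presheaf.map (homOfLE V.2).op 0 • φ.1 V = 0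
    rw [map_zero, zero_smul]

/-- Restriction of local homomorphisms to a smaller open set. -/
def homRestrict (M N : X.Modules) {U V : X.Opens} (h : V ≤ U) :
    homSections M N U →+ homSections M N V where
  toFun φ := ⟨fun W => φ.1 ⟨W.1, W.2.trans h⟩, fun W W' hW s =>
    φ.2 ⟨W.1, W.2.trans h⟩ ⟨W'.1, W'.2.trans h⟩ hW s⟩
  map_zero' := rfl
  map_add' _ _ := rfl

lemma homRestrict_smul (M N : X.Modules) {U V : X.Opens} (h : V ≤ U) (r : Γ(X, U))
    (φ : homSections M N U) :
    homRestrict M N h (r • φ) = X.presheaf.map (homOfLE h).op r • homRestrict M N h φ := by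
  refine Subtype.ext (funext fun W => ?_)
  change X.presheaf.map (homOfLE (W.2.trans h)).op r • φ.1 ⟨W.1, W.2.trans h⟩ =
    X.presheaf.map (homOfLE W.2).op (X.presheaf.map (homOfLE h).op r) •
      φ.1 ⟨W.1, W.2.trans h⟩
  rw [← ConcreteCategory.comp_apply, ← X.presheaf.map_comp]
  rfl

/-- The underlying presheaf of abelian groups of `ℋom(M, N)`. -/
def homAbPresheaf (M N : X.Modules) : X.Opensᵒᵖ ⥤ Ab.{u} where
  obj U := AddCommGrpCat.of (homSections M N U.unop)
  map i := AddCommGrpCat.ofHom (homRestrict M N (leOfHom i.unop))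
  map_id _ := rfl
  map_comp _ _ := rfl

instance (M N : X.Modules) (U : X.Opensᵒᵖ) :
    Module (X.ringCatSheaf.obj.obj U) ((homAbPresheaf M N).obj U) :=
  inferInstanceAs (Module Γ(X, U.unop) (homSections M N U.unop))

/-- The `𝒪_X`-module `ℋom(M, N)`. -/
def homPresheaf (M N : X.Modules) : X.PresheafOfModules :=
  PresheafOfModules.ofPresheaf (R := X.ringCatSheaf.obj) (homAbPresheaf M N) (by
    intro U V i r φ
    exact homRestrict_smul M N (leOfHom i.unop) r φ)

/-- The dual `M^* = ℋom(M, 𝒪_X)` (as a presheaf of modules; it is a sheaf). -/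
def dualPresheaf (M : X.Modules) : X.PresheafOfModules :=
  homPresheaf M (SheafOfModules.unit X.ringCatSheaf)

/-- The tensor product `M^* ⊗ N`: the sheaf associated to `U ↦ M^*(U) ⊗ N(U)`,
the tensor products being taken over `𝒪_X(U)`. -/
def dualTensor (M N : X.Modules) : X.Modules :=
  (PresheafOfModules.sheafification (𝟙 X.ringCatSheaf.obj)).obj
    (PresheafOfModules.Monoidal.tensorObj (R := X.presheaf)
      (dualPresheaf M) ((Scheme.Modules.toPresheafOfModules X).obj N))

end InternalHom

section Bundles

instance hasFiniteBiproducts (X : Scheme.{u}) : HasFiniteBiproducts X.Modules :=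
  Abelian.hasFiniteBiproducts

variable {X : Scheme.{u}}

/-- Vector bundles: `𝒪_X`-modules that are locally free of finite rank. -/
def IsVectorBundle (M : X.Modules) : Prop :=
  ∀ x : X, ∃ U : X.Opens, x ∈ U ∧ ∃ n : ℕ,
    Nonempty (M.restrict U.ι ≅
      (SheafOfModules.free (R := U.toScheme.ringCatSheaf) (ULift.{u} (Fin n)) :
        U.toScheme.Modules))

/-- An `𝒪_X`-module is globally generated if it is generated by a family of global sections. -/
def IsGloballyGenerated (M : X.Modules) : Prop :=
  Nonempty (SheafOfModules.GeneratingSections (R := X.ringCatSheaf) M)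

/-- The groups `Ext^p` are formed in the abelian category of `𝒪_X`-modules. -/
instance hasExt (X : Scheme.{u}) : HasExt.{u + 1} X.Modules := HasExt.standard X.Modules

variable {k : Type u} [Field k]

/-- The function on `U` given by a scalar `c : k`, for a scheme `X` over `k`. -/
def scalarSection (f : X ⟶ Spec (CommRingCat.of k)) (U : X.Opens) : k →+* Γ(X, U) :=
  ((Scheme.ΓSpecIso (CommRingCat.of k)).inv ≫ f.appTop ≫
    X.presheaf.map (homOfLE le_top).op).hom

/-- `M` is simple: `Hom(M, M) = k`, that is, `M` is nonzero and each of its endomorphisms is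
multiplication by a scalar. -/
def IsSimpleBundle (f : X ⟶ Spec (CommRingCat.of k)) (M : X.Modules) : Prop :=
  ¬ IsZero M ∧ ∀ φ : M ⟶ M, ∃ c : k, ∀ (U : X.Opens) (s : Γ(M, U)),
    φ.app U s = scalarSection f U c • s

/-- Exceptional vector bundles. -/
structure IsExceptional (f : X ⟶ Spec (CommRingCat.of k)) (M : X.Modules) : Prop where
  isVectorBundle : IsVectorBundle M
  isSimple : IsSimpleBundle f M
  ext_eq_zero : ∀ p : ℕ, 1 ≤ p → Subsingleton (Abelian.Ext.{u + 1} M M p)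

/-- Strongly exceptional ordered pairs of vector bundles. -/
structure IsStronglyExceptional (f : X ⟶ Spec (CommRingCat.of k)) (E F : X.Modules) :
    Prop where
  left : IsExceptional f E
  right : IsExceptional f F
  ext_right_left : ∀ p : ℕ, Subsingleton (Abelian.Ext.{u + 1} F E p)
  ext_left_right : ∀ p : ℕ, p ≠ 0 → Subsingleton (Abelian.Ext.{u + 1} E F p)

/-- Steiner bundles of type `(E, F)`: vector bundles `C` with a short exact sequence
`0 → E^a → F^b → C → 0`, where `a, b ≥ 1`, the pair `(E, F)` is strongly exceptional and
`E^* ⊗ F` is globally generated. -/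
structure IsSteinerBundle (f : X ⟶ Spec (CommRingCat.of k)) (E F C : X.Modules) : Prop where
  stronglyExceptional : IsStronglyExceptional f E F
  globallyGenerated : IsGloballyGenerated (dualTensor E F)
  isVectorBundle : IsVectorBundle C
  exists_shortExact : ∃ a b : ℕ, 1 ≤ a ∧ 1 ≤ b ∧
    ∃ (α : (⨁ fun _ : Fin a => E) ⟶ (⨁ fun _ : Fin b => F)) (π : (⨁ fun _ : Fin b => F) ⟶ C)
      (w : α ≫ π = 0), (ShortComplex.mk α π w).ShortExact

end Bundles

end

end SteinerBundles

namespace SteinerBundles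

section ExtVanishing

universe w v v'

variable {A : Type v} [Category.{v'} A] [Abelian A] [HasExt.{w} A]

/-! The proof is two rounds of long exact Ext sequences. The resolution of `C₁` traps `Ext^p(C₁,
C₂)` between `Ext^{p-1}(E, C₂)` and `Ext^p(F, C₂)`, up to finite direct sums. The resolution of `C₂`
then traps the former between `Ext^{p-1}(E, F)` and `Ext^p(E, E)`, and the latter between `Ext^p(F,
F)` and `Ext^{p+1}(F, E)`. All four vanish for a strongly exceptional pair once `p ≥ 2`. -/

/-- `Ext^n(⨁ Y, Z)` vanishes if every `Ext^n(Y j, Z)` does. -/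
lemma subsingleton_ext_biproduct_left [HasFiniteBiproducts A] {J : Type} [Fintype J]
    (Y : J → A) (Z : A) (n : ℕ) (h : ∀ j, Subsingleton (Abelian.Ext.{w} (Y j) Z n)) :
    Subsingleton (Abelian.Ext.{w} (⨁ Y) Z n) :=
  (Abelian.Ext.biproductAddEquiv (biproduct.isBilimit Y) Z n).toEquiv.subsingleton

/-- `Ext^n(Z, ⨁ Y)` vanishes if every `Ext^n(Z, Y j)` does. -/
lemma subsingleton_ext_biproduct_right [HasFiniteBiproducts A] {J : Type} [Fintype J]
    (Z : A) (Y : J → A) (n : ℕ) (h : ∀ j, Subsingleton (Abelian.Ext.{w} Z (Y j) n)) :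
    Subsingleton (Abelian.Ext.{w} Z (⨁ Y) n) :=
  (Abelian.Ext.addEquivBiproduct Z (biproduct.isBilimit Y) n).toEquiv.subsingleton

/-- Vanishing of `Ext^n(Z, -)` at the cokernel of a short exact sequence. -/
lemma subsingleton_ext_cokernel_right {S : ShortComplex A} (hS : S.ShortExact) (Z : A) (n : ℕ)
    (h₂ : Subsingleton (Abelian.Ext.{w} Z S.X₂ n))
    (h₁ : Subsingleton (Abelian.Ext.{w} Z S.X₁ (n + 1))) :
    Subsingleton (Abelian.Ext.{w} Z S.X₃ n) := by
  refine subsingleton_of_forall_eq 0 fun x => ?_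
  -- The connecting map sends `x` into `Ext^{n+1}(Z, S.X₁) = 0`, so `x` lifts to `Ext^n(Z, S.X₂)`.
  obtain ⟨y, rfl⟩ :=
    Abelian.Ext.covariant_sequence_exact₃ Z hS x rfl (Subsingleton.elim _ _)
  rw [Subsingleton.elim y 0, Abelian.Ext.zero_comp]

/-- Vanishing of `Ext^{n+1}(-, Z)` at the cokernel of a short exact sequence. -/
lemma subsingleton_ext_cokernel_left {S : ShortComplex A} (hS : S.ShortExact) (Z : A) (n : ℕ)
    (h₁ : Subsingleton (Abelian.Ext.{w} S.X₁ Z n))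
    (h₂ : Subsingleton (Abelian.Ext.{w} S.X₂ Z (n + 1))) :
    Subsingleton (Abelian.Ext.{w} S.X₃ Z (n + 1)) := by
  refine subsingleton_of_forall_eq 0 fun x => ?_
  -- The pullback of `x` to `S.X₂` is zero, so `x` is the extension class of `S` composed with some
  -- `y` in `Ext^n(S.X₁, Z)`.
  obtain ⟨y, rfl⟩ :=
    Abelian.Ext.contravariant_sequence_exact₃ hS Z x (Subsingleton.elim _ _) (add_comm 1 n)
  rw [Subsingleton.elim y 0, Abelian.Ext.comp_zero]

end ExtVanishing

variable {k : Type u} [Field k] {X : Scheme.{u}} {f : X ⟶ Spec (CommRingCat.of k)}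
  {E F C : X.Modules}

/-- `Ext^n(Z, C)` vanishes for a Steiner bundle `C` of type `(E, F)` if `Ext^n(Z, F)` and
`Ext^{n+1}(Z, E)` do. -/
lemma IsSteinerBundle.subsingleton_ext_right (hC : IsSteinerBundle f E F C) (Z : X.Modules)
    (n : ℕ) (hF : Subsingleton (Abelian.Ext.{u + 1} Z F n))
    (hE : Subsingleton (Abelian.Ext.{u + 1} Z E (n + 1))) :
    Subsingleton (Abelian.Ext.{u + 1} Z C n) := by
  obtain ⟨a, b, -, -, α, π, w, hS⟩ := hC.exists_shortExact
  exact subsingleton_ext_cokernel_right hS Z n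
    (subsingleton_ext_biproduct_right Z _ n fun _ => hF)
    (subsingleton_ext_biproduct_right Z _ (n + 1) fun _ => hE)

/-- `Ext^{n+1}(C, Z)` vanishes for a Steiner bundle `C` of type `(E, F)` if `Ext^n(E, Z)` and
`Ext^{n+1}(F, Z)` do. -/
lemma IsSteinerBundle.subsingleton_ext_left (hC : IsSteinerBundle f E F C) (Z : X.Modules)
    (n : ℕ) (hE : Subsingleton (Abelian.Ext.{u + 1} E Z n))
    (hF : Subsingleton (Abelian.Ext.{u + 1} F Z (n + 1))) :
    Subsingleton (Abelian.Ext.{u + 1} C Z (n + 1)) := by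
  obtain ⟨a, b, -, -, α, π, w, hS⟩ := hC.exists_shortExact
  exact subsingleton_ext_cokernel_left hS Z n
    (subsingleton_ext_biproduct_left _ Z n fun _ => hE)
    (subsingleton_ext_biproduct_left _ Z (n + 1) fun _ => hF)

end SteinerBundles

theorem mainTheorem8 {k : Type u} [Field k] [IsAlgClosed k] [CharZero k]
    {X : Scheme.{u}} (f : X ⟶ Spec (CommRingCat.of k))
    [Smooth f] [IsSeparated f] [QuasiCompact f] [IrreducibleSpace X]
    (E F C₁ C₂ : X.Modules)
    (h₁ : SteinerBundles.IsSteinerBundle f E F C₁)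
    (h₂ : SteinerBundles.IsSteinerBundle f E F C₂)
    (p : ℕ) (hp : 2 ≤ p) :
    Subsingleton (Abelian.Ext.{u + 1} C₁ C₂ p) := by
  obtain ⟨n, rfl⟩ : ∃ n, p = n + 1 := ⟨p - 1, by omega⟩
  have hEF := h₂.stronglyExceptional
  refine h₁.subsingleton_ext_left C₂ n ?_ ?_
  -- Here alone `p ≥ 2` matters: it gives `n ≠ 0`, and `Hom(E, F)` is not assumed to vanish.
  · exact h₂.subsingleton_ext_right E n (hEF.ext_left_right n (by omega))
      (hEF.left.ext_eq_zero (n + 1) (by omega))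
  · exact h₂.subsingleton_ext_right F (n + 1) (hEF.right.ext_eq_zero (n + 1) (by omega))
      (hEF.ext_right_left (n + 2))
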